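/- Let $K$ be a field, let $a_1,\dots,a_n$ and $b_1,\dots,b_n$ be nonnegative integers, and let $X=(x_{i_1,\dots,i_n})$, $1\le i_t\le a_t$, be the tensor of independent variables of size $a_1\times\cdots\times a_n$. For an index $i$, an $i$-th flattening matrix of $X$ is an $a_i\times(a_1\cdots a_{i-1}a_{i+1}\cdots a_n)$ matrix whose columns are all the vectors $(x_{i_1,\dots,1,\dots,i_n},\dots,x_{i_1,\dots,a_i,\dots,i_n})^T$ (the $i$-th index varies, the others are fixed), each occurring once, in an arbitrary order. The subspace variety is $$\mathrm{\hat{S}ub}_{b_1,\dots,b_n}(K^{a_1}\otimes\cdots\otimes K^{a_n})=\{T\in K^{a_1}\otimes\cdots\otimes K^{a_n} : \dim T((K^{a_i})^*)\le b_i \text{ for all } 1\le i\le n\},$$ where $T$ is viewed as the contraction map $(K^{a_i})^*\to\bigotimes_{t\ne i}K^{a_t}$. Let $j,k\in\{1,\dots,n\}$ and suppose that $b_i\ge a_i$ for all $i\ne j,k$. Let $X_j$ and $X_k$ be a $j$-th and a $k$-th flattening matrix of $X$. Then the ideal of $K[x_{i_1,\dots,i_n}]$ generated by the $(b_j+1)$-minors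 of $X_j$ together with the $(b_k+1)$-minors of $X_k$ is prime, and its zero set in $K^{a_1}\otimes\cdots\otimes K^{a_n}$ is $\mathrm{\hat{S}ub}_{b_1,\dots,b_n}(K^{a_1}\otimes\cdots\otimes K^{a_n})$. Moreover, there is a monomial order, independent of the choice of $X_j$ and $X_k$, with respect to which these minors form a Gröbner basis of that ideal. -/

import Mathlib

namespace TensorFlattening

/-- The multi-indices `(i_1, …, i_n)` of a tensor of size `a_1 × ⋯ × a_n`. -/
abbrev MultiIndex {n : ℕ} (a : Fin n → ℕ) : Type := (i : Fin n) → Fin (a i)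

/-- The multi-indices from which the `j`-th index has been removed. -/
abbrev MultiIndexAway {n : ℕ} (a : Fin n → ℕ) (j : Fin n) : Type :=
  (i : {i : Fin n // i ≠ j}) → Fin (a i)

/-- A tensor of size `a_1 × ⋯ × a_n` over `K`: an element of `K^{a_1} ⊗ ⋯ ⊗ K^{a_n}`, given by its
array of coordinates in the standard basis. -/
abbrev Tensor (K : Type*) {n : ℕ} (a : Fin n → ℕ) : Type _ := MultiIndex a → K

/-- Insert `t` as the `j`-th index: the multi-index `(s_1, …, s_{j-1}, t, s_{j+1}, …, s_n)`. -/
def insertIndex {n : ℕ} {a : Fin n → ℕ} (j : Fin n) (t : Fin (a j)) (s : MultiIndexAway a j) :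
    MultiIndex a :=
  (Equiv.piSplitAt j (fun i => Fin (a i))).symm (t, s)

/-- The contraction map of a tensor `T` in the `j`-th factor,
`(K^{a_j})^* → K^{a_1} ⊗ ⋯ ⊗ K^{a_{j-1}} ⊗ K^{a_{j+1}} ⊗ ⋯ ⊗ K^{a_n}`, which sends `f` to the
array obtained by applying `f` to every fiber of `T` in direction `j`. -/
def contraction {K : Type*} [Field K] {n : ℕ} {a : Fin n → ℕ} (T : Tensor K a) (j : Fin n) :
    Module.Dual K (Fin (a j) → K) →ₗ[K] (MultiIndexAway a j → K) :=
  LinearMap.pi fun s => Module.Dual.eval K (Fin (a j) → K) (fun t => T (insertIndex j t s))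

/-- The subspace variety `Sub_{b_1, …, b_n}(K^{a_1} ⊗ ⋯ ⊗ K^{a_n})`: all tensors `T` with
`dim T((K^{a_i})^*) ≤ b_i` for every `i`. -/
def subspaceVariety (K : Type*) [Field K] {n : ℕ} (a b : Fin n → ℕ) : Set (Tensor K a) :=
  {T | ∀ i, Module.finrank K (LinearMap.range (contraction T i)) ≤ b i}

/-- The number of columns `a_1 ⋯ a_{j-1} a_{j+1} ⋯ a_n` of a `j`-th flattening. -/
abbrev flatteningWidth {n : ℕ} (a : Fin n → ℕ) (j : Fin n) : ℕ :=
  ∏ i : {i : Fin n // i ≠ j}, a i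

/-- The `j`-th flattening class of the tensor of variables of size `a_1 × ⋯ × a_n`: all matrices
whose columns are the fibers in direction `j`, each occurring once, listed in an arbitrary order. -/
def flatteningClass (K : Type*) [Field K] {n : ℕ} (a : Fin n → ℕ) (j : Fin n) :
    Set (Matrix (Fin (a j)) (Fin (flatteningWidth a j)) (MvPolynomial (MultiIndex a) K)) :=
  {M | ∃ e : Fin (flatteningWidth a j) ≃ MultiIndexAway a j,
    M = Matrix.of fun t c => MvPolynomial.X (insertIndex j t (e c))}

theorem flatteningClass_nonempty (K : Type*) [Field K] {n : ℕ} (a : Fin n → ℕ) (j : Fin n) :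
    (flatteningClass K a j).Nonempty :=
  ⟨_, (Fintype.equivFinOfCardEq (by simp)).symm, rfl⟩

/-- The set of `u`-minors of a matrix: the determinants of its `u × u` submatrices. -/
def minors {R : Type*} [CommRing R] {p q : ℕ} (u : ℕ) (A : Matrix (Fin p) (Fin q) R) : Set R :=
  {d | ∃ (r : Fin u ↪o Fin p) (c : Fin u ↪o Fin q), d = (A.submatrix r c).det}

/-- A finite set `G` of polynomials is a Gröbner basis (of the ideal `I` it generates) with respect
to the monomial order `m` if the leading terms of the elements of `G` generate the initial ideal,
that is, the ideal generated by the leading terms of all elements of `I`. -/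
def IsGroebnerBasis {σ K : Type*} [Field K] (m : MonomialOrder σ) (G : Set (MvPolynomial σ K)) :
    Prop :=
  G.Finite ∧
    Ideal.span (m.leadingTerm '' (Ideal.span G : Set (MvPolynomial σ K))) =
      Ideal.span (m.leadingTerm '' G)

end TensorFlattening

/-! Cut the tensor into slices in directions `j` and `k`, and let `p = b j`, `q = b k`. The
substitution making slice `s` equal to `P * Y s * Q`, where `P` has `p` columns and `Q` has `q`
rows, kills the minors: both flattenings factor through dimension `p` or `q`. Its kernel is prime
because the target is a domain. Primality and the Gröbner property follow once the leading monomial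
of every nonzero kernel element is divisible by that of some minor. If `j = k`, each slice is a
single column and `q = 1` does the job.

Order the variables by slice, row, column. The leading monomials of the minors then include the
products of all chains, for `ChainLt s r c` of length `p + 1` and for `ChainLt s c r` of length `q +
1`. If a monomial `lam` contains no such chain, label each of its cells by its levels in the two
chain orders. The labels fit into `Fin p` and `Fin q`, so they select one term of the expanded image
of `lam`, whose exponent records the marginals of the labelling. The core is
`filling_le_of_marginals_eq`: any other filling with these marginals has more elements in the first
cell whose contents differ, so it comes from a lex-larger monomial. Hence the term cannot cancel in
the image of a polynomial with leading monomial `lam` (`parametrization_ne_zero`).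

The zero set is the rank condition in directions `j` and `k`; the other ranks are at most `a i ≤ b
i`. -/

namespace TensorFlattening

/-! ### Levels in a finite set with a strict relation -/

section Levels

variable {σ : Type*}

/-- `lev` assigns to every element of `S` the length of the longest `R`-chain in `S` below it. -/
structure IsLevel (R : σ → σ → Prop) (S : Finset σ) (lev : σ → ℕ) : Prop where
  lt : ∀ x ∈ S, ∀ y ∈ S, R x y → lev x < lev y
  pred : ∀ y ∈ S, ∀ l, lev y = l + 1 → ∃ x ∈ S, R x y ∧ lev x = l

theorem exists_isLevel [LinearOrder σ] (R : σ → σ → Prop) (hR : ∀ x y, R x y → x < y)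
    (S : Finset σ) : ∃ lev, IsLevel R S lev := by
  classical
  induction S using Finset.induction_on_max with
  | empty => exact ⟨fun _ => 0, by simp, by simp⟩
  | insert a S ha ih =>
    obtain ⟨lev, h₁, h₂⟩ := ih
    have hne : ∀ x ∈ S, x ≠ a := fun x hx => (ha x hx).ne
    -- The new element is the maximum, so it lies below nothing and old levels persist. The empty
    -- supremum gives minimal elements level `0`.
    refine ⟨Function.update lev a ((S.filter (R · a)).sup fun x => lev x + 1), ?_, ?_⟩
    · intro x hx y hy hxy
      have hlt := hR x y hxy
      rcases Finset.mem_insert.1 hx with rfl | hxS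
      · rcases Finset.mem_insert.1 hy with rfl | hy
        · exact absurd hlt (lt_irrefl _)
        · exact absurd (hlt.trans (ha y hy)) (lt_irrefl _)
      · rw [Function.update_of_ne (hne x hxS)]
        rcases Finset.mem_insert.1 hy with rfl | hy
        · rw [Function.update_self]
          exact Nat.lt_of_succ_le (Finset.le_sup (f := fun x => lev x + 1)
            (Finset.mem_filter.2 ⟨hxS, hxy⟩))
        · rw [Function.update_of_ne (hne y hy)]
          exact h₁ x hxS y hy hxy
    · intro y hy l hl
      rcases Finset.mem_insert.1 hy with rfl | hy
      · rw [Function.update_self] at hl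
        have hne' : (S.filter (R · y)).Nonempty := by
          rw [Finset.nonempty_iff_ne_empty]
          intro h
          simp [h] at hl
        obtain ⟨x, hx, hxl⟩ := Finset.exists_mem_eq_sup _ hne' (fun x => lev x + 1)
        obtain ⟨hxS, hxy⟩ := Finset.mem_filter.1 hx
        refine ⟨x, Finset.mem_insert_of_mem hxS, hxy, ?_⟩
        rw [Function.update_of_ne (hne x hxS)]
        have := hxl.symm.trans hl
        simpa using this
      · rw [Function.update_of_ne (hne y hy)] at hl
        obtain ⟨x, hx, hxy, hxl⟩ := h₂ y hy l hl
        exact ⟨x, Finset.mem_insert_of_mem hx, hxy, by rwa [Function.update_of_ne (hne x hx)]⟩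

namespace IsLevel

variable {R : σ → σ → Prop} {S : Finset σ} {lev : σ → ℕ}

/-- This compares elements that need not be related: a predecessor of `x` one level down also lies
below `y`. -/
theorem le_of_forall (h : IsLevel R S lev) {x y : σ} (hx : x ∈ S) (hy : y ∈ S)
    (hxy : ∀ w, R w x → R w y) : lev x ≤ lev y := by
  rcases hl : lev x with _ | l
  · exact Nat.zero_le _
  · obtain ⟨w, hw, hwx, rfl⟩ := h.pred x hx l hl
    exact h.lt w hw y hy (hxy w hwx)

theorem exists_below (h : IsLevel R S lev) (hR : ∀ x y z, R x y → R y z → R x z) :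
    ∀ d, ∀ y ∈ S, ∀ l, lev y = l + 1 + d → ∃ x ∈ S, R x y ∧ lev x = l := by
  intro d
  induction d with
  | zero => exact fun y hy l hl => h.pred y hy l hl
  | succ d ih =>
    intro y hy l hl
    obtain ⟨w, hw, hwy, hwl⟩ := h.pred y hy (l + 1 + d) hl
    obtain ⟨x, hx, hxw, hxl⟩ := ih w hw l hwl
    exact ⟨x, hx, hR _ _ _ hxw hwy, hxl⟩

theorem exists_chain (h : IsLevel R S lev) (hR : ∀ x y z, R x y → R y z → R x z) :
    ∀ l, ∀ z ∈ S, lev z = l →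
      ∃ f : ℕ → σ, f l = z ∧ (∀ x ≤ l, f x ∈ S) ∧ ∀ x y, x < y → y ≤ l → R (f x) (f y) := by
  intro l
  induction l with
  | zero =>
    exact fun z hz _ => ⟨fun _ => z, rfl, fun _ _ => hz, fun x y h₁ h₂ => by omega⟩
  | succ l ih =>
    intro z hz hl
    obtain ⟨w, hw, hwz, hwl⟩ := h.pred z hz l hl
    obtain ⟨f, hfl, hfS, hfR⟩ := ih w hw hwl
    refine ⟨fun x => if x ≤ l then f x else z, by simp, ?_, ?_⟩
    · intro x _
      dsimp only
      split_ifs with hx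
      · exact hfS x hx
      · exact hz
    · intro x y hxy hy
      have hx : x ≤ l := by omega
      dsimp only
      rw [if_pos hx]
      split_ifs with hy'
      · exact hfR x y hxy hy'
      · rcases Nat.lt_or_ge x l with hxl | hxl
        · exact hR _ _ _ (hfR x l hxl le_rfl) (hfl ▸ hwz)
        · obtain rfl : x = l := by omega
          exact hfl ▸ hwz

/-- Levels start at `0`, so level `p` already forces `p + 1` elements. -/
theorem exists_chain_of_le (h : IsLevel R S lev) (hR : ∀ x y z, R x y → R y z → R x z)
    {z : σ} (hz : z ∈ S) {p : ℕ} (hp : p ≤ lev z) :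
    ∃ f : Fin (p + 1) → σ, (∀ x, f x ∈ S) ∧ ∀ x y, x < y → R (f x) (f y) := by
  obtain ⟨f, -, hfS, hfR⟩ := h.exists_chain hR (lev z) z hz rfl
  exact ⟨fun x => f x, fun x => hfS _ (by omega), fun x y hxy => hfR _ _ hxy (by omega)⟩

end IsLevel

end Levels

/-! ### Chains of cells and fillings with given marginals -/

section Chains

variable {σ : Type*}

/-- The strict order on cells with slice `s`, row `r` and column `c` in which the diagonals of
the concatenation of all slices along the columns are the chains. -/
def ChainLt (s r c : σ → ℕ) (x y : σ) : Prop :=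
  r x < r y ∧ (s x < s y ∨ s x = s y ∧ c x < c y)

theorem ChainLt.trans {s r c : σ → ℕ} (x y z : σ) (h₁ : ChainLt s r c x y)
    (h₂ : ChainLt s r c y z) : ChainLt s r c x z := by
  unfold ChainLt at *
  omega

/-- If `lb x < lb y`, a predecessor `v` of `y` for `lb` is not below `x`, which places it in the
same slice, in a row between those of `x` and `y`, with smaller `la`. Some `w` below `x` has the
`la`-level of `v`; it lies in the same slice and above `v`. Induction gives `lb v ≤ lb w < lb x ≤ lb
v`. -/
theorem level_antitone {s r c : σ → ℕ} {S : Finset σ} {la lb : σ → ℕ}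
    (ha : IsLevel (ChainLt s r c) S la) (hb : IsLevel (ChainLt s c r) S lb) :
    ∀ l, ∀ x ∈ S, ∀ y ∈ S, la x = l → la y = l → s x = s y → r x < r y → lb y ≤ lb x := by
  intro l
  induction l using Nat.strong_induction_on with
  | h l ih =>
    intro x hx y hy hlx hly hs hr
    by_contra! hlt
    have hcyx : c y ≤ c x := by
      by_contra! hc
      have := ha.lt x hx y hy ⟨hr, Or.inr ⟨hs, hc⟩⟩
      omega
    obtain ⟨v, hv, hvy, hvl⟩ := hb.pred y hy (lb y - 1) (by omega)
    have hvx : ¬ ChainLt s c r v x := fun h => by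
      have := hb.lt v hv x hx h
      omega
    have hsv : s v = s y ∧ r x ≤ r v ∧ r v < r y ∧ c v < c y := by
      unfold ChainLt at hvy hvx
      omega
    have hav : la v < la y := ha.lt v hv y hy ⟨hsv.2.2.1, Or.inr ⟨hsv.1, hsv.2.2.2⟩⟩
    obtain ⟨w, hw, hwx, hwl⟩ := ha.exists_below ChainLt.trans (la x - la v - 1) x hx (la v)
      (by omega)
    have hwv : ¬ ChainLt s r c w v := fun h => by
      have := ha.lt w hw v hv h
      omega
    have hsw : s w = s x ∧ c v ≤ c w ∧ r w < r x ∧ c w < c x := by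
      unfold ChainLt at hwx hwv
      omega
    have h₁ := ih (la v) (by omega) w hw v hv hwl rfl (by omega) (by omega)
    have h₂ := hb.lt w hw x hx ⟨hsw.2.2.2, Or.inr ⟨hsw.1, hsw.2.2.1⟩⟩
    omega

/-- Unprimed data belong to the reference cell, primed data to a later cell of the level filling.
Where the `+1` occurs, exactly one `-1` cancels it: the first in a later row, the second in the same
row. Elsewhere `h₃` and `h₄`, supplied by `level_antitone`, exclude every `-1`. -/
theorem filling_weight_eq_zero {k i j a b k' i' j' a' b' : ℕ}
    (hgt : k < k' ∨ k = k' ∧ (i < i' ∨ i = i' ∧ j < j'))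
    (h₁ : i < i' ∧ (k < k' ∨ k = k' ∧ j < j') → a < a')
    (h₂ : j < j' ∧ (k < k' ∨ k = k' ∧ i < i') → b < b')
    (h₃ : a' = a → k = k' → i < i' → b' ≤ b) (h₄ : b' = b → k = k' → j < j' → a' ≤ a)
    (h₅ : j ≤ j' → b ≤ b') (h₆ : i ≤ i' → (k < k' ∨ k = k' ∧ j ≤ j') → a ≤ a') :
    (if i < i' ∧ a' = a then -1 else 0) + (if k' = k ∧ a' = a ∧ b' ≤ b then 1 else 0) +
      ((if b' = b ∧ j < j' then -1 else 0) + (if b' < b ∧ j ≤ j' then -1 else 0)) = (0 : ℤ) := by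
  rw [if_neg (c := b' < b ∧ j ≤ j') (by omega)]
  by_cases hg : k' = k ∧ a' = a ∧ b' ≤ b
  · rw [if_pos hg]
    by_cases hi : i < i'
    · rw [if_pos ⟨hi, hg.2.1⟩, if_neg (by omega)]
      rfl
    · rw [if_neg (by omega), if_pos (by omega)]
      rfl
  · rw [if_neg hg, if_neg (by omega), if_neg (by omega)]
    rfl

/-- Among all fillings with prescribed marginals, the one given by the levels of a set of cells has
the fewest elements in the first cell where it differs from another one. -/
theorem filling_le_of_marginals_eq [Fintype σ] {s r c : σ → ℕ} [LinearOrder σ]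
    (hlt : ∀ x y : σ, x < y ↔ s x < s y ∨ s x = s y ∧ (r x < r y ∨ r x = r y ∧ c x < c y))
    {S : Finset σ} {la lb : σ → ℕ}
    (ha : IsLevel (ChainLt s r c) S la) (hb : IsLevel (ChainLt s c r) S lb) {p q : ℕ}
    (N N' : σ × Fin p × Fin q → ℕ)
    (hN : ∀ t, N t ≠ 0 → t.1 ∈ S ∧ la t.1 = t.2.1 ∧ lb t.1 = t.2.2)
    (hm : ∀ (f : ℕ → Fin p → ℤ) (g : ℕ → Fin p → Fin q → ℤ) (h : Fin q → ℕ → ℤ),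
      ∑ t, ((N t : ℤ) - N' t) *
        (f (r t.1) t.2.1 + g (s t.1) t.2.1 t.2.2 + h t.2.2 (c t.1)) = 0)
    (t₀ : σ × Fin p × Fin q) (hlow : ∀ t, t.1 < t₀.1 → N t = N' t) : N t₀ ≤ N' t₀ := by
  by_contra! hlt₀
  obtain ⟨hz, hza, hzb⟩ := hN t₀ (by omega)
  -- These weights add up to `1` at `t₀`, to `0` at all elements of the level filling in later
  -- cells, and to at most `0` at all other elements in the cell of `t₀` or later. Earlier cells
  -- contribute nothing by `hlow`, so the sum is positive. The final `-1` handles smaller second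
  -- labels within the cell of `t₀` or later in its row.
  have key := hm (fun i a => if r t₀.1 < i ∧ (a : ℕ) = t₀.2.1 then -1 else 0)
    (fun k a b => if k = s t₀.1 ∧ (a : ℕ) = t₀.2.1 ∧ (b : ℕ) ≤ t₀.2.2 then 1 else 0)
    (fun b j => (if (b : ℕ) = t₀.2.2 ∧ c t₀.1 < j then -1 else 0) +
      (if (b : ℕ) < t₀.2.2 ∧ c t₀.1 ≤ j then -1 else 0))
  refine (Finset.sum_pos' ?_ ⟨t₀, Finset.mem_univ _, ?_⟩).ne' key
  · intro t _
    by_cases htt : t = t₀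
    · subst htt
      simp only [lt_irrefl, le_refl, and_true, if_true, if_false, and_false]
      omega
    rcases lt_or_ge t.1 t₀.1 with h | h
    · simp [hlow t h]
    by_cases ht : N t = 0
    · rw [ht, Nat.cast_zero, zero_sub, neg_mul_comm]
      refine mul_nonneg (Int.natCast_nonneg _) ?_
      have hge : ¬ t.1 < t₀.1 := h.not_gt
      rw [hlt] at hge
      have hne : t.1 = t₀.1 → t.2.1 = (t₀.2.1 : ℕ) → (t.2.2 : ℕ) = t₀.2.2 → False := fun h₁ h₂ h₃ =>
        htt (Prod.ext h₁ (Prod.ext (Fin.ext h₂) (Fin.ext h₃)))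
      have hcell : s t.1 = s t₀.1 → r t.1 = r t₀.1 → c t.1 = c t₀.1 → t.1 = t₀.1 :=
        fun h₁ h₂ h₃ => le_antisymm (not_lt.1 fun h' => by rw [hlt] at h'; omega) h
      split_ifs <;> grind
    · obtain ⟨hS, hta, htb⟩ := hN t ht
      have hne : t.1 ≠ t₀.1 := fun h' => htt (Prod.ext h' (Prod.ext
        (Fin.ext (by rw [← hta, ← hza, h'])) (Fin.ext (by rw [← htb, ← hzb, h']))))
      have hgt := (hlt _ _).1 (lt_of_le_of_ne h hne.symm)
      have h₁ := ha.lt t₀.1 hz t.1 hS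
      have h₂ := hb.lt t₀.1 hz t.1 hS
      have h₃ := level_antitone ha hb (la t₀.1) t₀.1 hz t.1 hS rfl
      have h₄ := level_antitone hb ha (lb t₀.1) t₀.1 hz t.1 hS rfl
      have h₅ : c t₀.1 ≤ c t.1 → lb t₀.1 ≤ lb t.1 := fun hc => hb.le_of_forall hz hS fun w hw => by
        unfold ChainLt at *
        omega
      have h₆ : r t₀.1 ≤ r t.1 → (s t₀.1 < s t.1 ∨ s t₀.1 = s t.1 ∧ c t₀.1 ≤ c t.1) →
          la t₀.1 ≤ la t.1 := fun hr hc => ha.le_of_forall hz hS fun w hw => by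
        unfold ChainLt at *
        omega
      refine le_of_eq (Eq.symm (mul_eq_zero_of_right _ ?_))
      rw [← hta, ← htb, ← hza, ← hzb]
      exact filling_weight_eq_zero hgt h₁ h₂ (fun h => h₃ h) (fun h => h₄ h) h₅ h₆
  · simp only [lt_irrefl, le_refl, and_true, if_true, if_false, and_false]
    omega

end Chains

open MvPolynomial

/-! ### The substitution `P * Y s * Q` and its surviving term -/

section Parametrization

variable {σ : Type*} {p q : ℕ}

/-- The entries of factors `P`, `Y s` and `Q` of the slices `P * Y s * Q` of a tensor. -/
abbrev FactorEntry (p q : ℕ) : Type := (ℕ × Fin p) ⊕ (ℕ × Fin p × Fin q) ⊕ (Fin q × ℕ)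

/-- The exponent of `P (r z) a * Y (s z) a b * Q b (c z)`. -/
noncomputable def termExponent (s r c : σ → ℕ) (t : σ × Fin p × Fin q) :
    FactorEntry p q →₀ ℕ :=
  Finsupp.single (.inl (r t.1, t.2.1)) 1 + Finsupp.single (.inr (.inl (s t.1, t.2.1, t.2.2))) 1 +
    Finsupp.single (.inr (.inr (t.2.2, c t.1))) 1

/-- The substitution of the generic tensor with slices `P * Y s * Q`. -/
noncomputable def parametrization (K : Type*) [Field K] (s r c : σ → ℕ) (p q : ℕ) :
    MvPolynomial σ K →ₐ[K] MvPolynomial (FactorEntry p q) K :=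
  aeval fun z => ∑ ab : Fin p × Fin q, monomial (termExponent s r c (z, ab)) 1

/-- The positions in the monomial with exponent `μ`, with their cell and the labels `g`. -/
def labelled {μ : σ →₀ ℕ} (g : (Σ z, Fin (μ z)) → Fin p × Fin q) (e : Σ z, Fin (μ z)) :
    σ × Fin p × Fin q := (e.1, g e)

variable [Fintype σ]

/-- `Σ z, Fin (μ z)` indexes the factors of the monomial with multiplicity; expanding the product
chooses a pair of labels for each factor. -/
theorem parametrization_monomial [DecidableEq σ] (K : Type*) [Field K] (s r c : σ → ℕ)
    (μ : σ →₀ ℕ) :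
    parametrization K s r c p q (monomial μ 1) =
      ∑ g : (Σ z, Fin (μ z)) → Fin p × Fin q,
        monomial (∑ e, termExponent s r c (labelled g e)) 1 := by
  rw [parametrization, aeval_monomial, map_one, one_mul, Finsupp.prod_fintype _ _ (by simp)]
  have h : ∀ z, (∑ ab : Fin p × Fin q, monomial (termExponent s r c (z, ab)) (1 : K)) ^ μ z =
      ∏ _x : Fin (μ z), ∑ ab : Fin p × Fin q, monomial (termExponent s r c (z, ab)) (1 : K) := by
    intro z
    rw [Finset.prod_const, Finset.card_univ, Fintype.card_fin]
  rw [Finset.prod_congr rfl fun z _ => h z, ← Fintype.prod_sigma (fun e : Σ z, Fin (μ z) =>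
      ∑ ab : Fin p × Fin q, monomial (termExponent s r c (e.1, ab)) (1 : K)),
    Finset.prod_univ_sum, Fintype.piFinset_univ]
  refine Finset.sum_congr rfl fun g _ => ?_
  rw [monomial_sum_one]
  rfl

theorem sum_card_fiber [DecidableEq σ] {M : Type*} [AddCommMonoid M] {ι : Type*} [Fintype ι]
    (f : ι → σ) (w : σ → M) :
    ∑ t, (Finset.univ.filter fun e => f e = t).card • w t = ∑ e, w (f e) := by
  rw [← Finset.sum_fiberwise Finset.univ f fun e => w (f e)]
  refine Finset.sum_congr rfl fun t _ => ?_
  rw [← Finset.sum_const]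
  exact Finset.sum_congr rfl fun e he => by rw [(Finset.mem_filter.1 he).2]

theorem sum_card_labelled [DecidableEq σ] {μ : σ →₀ ℕ} (g : (Σ z, Fin (μ z)) → Fin p × Fin q)
    (z : σ) : ∑ ab, (Finset.univ.filter fun e => labelled g e = (z, ab)).card = μ z := by
  have h := sum_card_fiber (labelled g) fun t => if t.1 = z then 1 else 0
  rw [Fintype.sum_prod_type, Fintype.sum_eq_single z] at h
  · simp only [if_true, smul_eq_mul, mul_one] at h
    rw [h]
    simp only [labelled]
    rw [Fintype.sum_sigma, Fintype.sum_eq_single z]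
    · simp only [if_true, Finset.sum_const, Finset.card_univ, Fintype.card_fin, smul_eq_mul,
        mul_one]
    · intro x hx
      exact Finset.sum_eq_zero fun _ _ => if_neg hx
  · intro x hx
    simp [hx]

/-- The filling of a monomial by its levels is determined by its marginals, among the fillings of
all monomials that are not larger. -/
theorem labelled_of_termExponent_eq [LinearOrder σ] {s r c : σ → ℕ}
    (hlt : ∀ x y : σ, x < y ↔ s x < s y ∨ s x = s y ∧ (r x < r y ∨ r x = r y ∧ c x < c y))
    {lam μ : σ →₀ ℕ} {la lb : σ → ℕ} (ha : IsLevel (ChainLt s r c) lam.support la)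
    (hb : IsLevel (ChainLt s c r) lam.support lb)
    (g₀ : (Σ z, Fin (lam z)) → Fin p × Fin q)
    (hg₀ : ∀ e, la e.1 = (g₀ e).1 ∧ lb e.1 = (g₀ e).2)
    (g : (Σ z, Fin (μ z)) → Fin p × Fin q) (hle : toLex μ ≤ toLex lam)
    (h : ∑ e, termExponent s r c (labelled g e) = ∑ e, termExponent s r c (labelled g₀ e)) :
    μ = lam ∧ ∀ e, la e.1 = (g e).1 ∧ lb e.1 = (g e).2 := by
  set N : σ × Fin p × Fin q → ℕ := fun t => (Finset.univ.filter fun e => labelled g₀ e = t).card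
    with hNdef
  set N' : σ × Fin p × Fin q → ℕ := fun t => (Finset.univ.filter fun e => labelled g e = t).card
    with hNdef'
  have hN : ∀ t, N t ≠ 0 → t.1 ∈ lam.support ∧ la t.1 = t.2.1 ∧ lb t.1 = t.2.2 := by
    intro t ht
    obtain ⟨e, he⟩ := Finset.card_ne_zero.1 ht
    obtain rfl := (Finset.mem_filter.1 he).2
    exact ⟨Finsupp.mem_support_iff.2 (Nat.ne_of_gt (Fin.pos e.2)), hg₀ e⟩
  have hm : ∀ (f : ℕ → Fin p → ℤ) (g : ℕ → Fin p → Fin q → ℤ) (h : Fin q → ℕ → ℤ),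
      ∑ t, ((N t : ℤ) - N' t) *
        (f (r t.1) t.2.1 + g (s t.1) t.2.1 t.2.2 + h t.2.2 (c t.1)) = 0 := by
    intro f₁ f₂ f₃
    -- Equal exponents agree under every linear functional; the three kinds of factor entries carry
    -- the weights `f₁`, `f₂`, `f₃`.
    have h' := congrArg (Finsupp.linearCombination ℕ (Sum.elim (fun x => f₁ x.1 x.2)
      (Sum.elim (fun x => f₂ x.1 x.2.1 x.2.2) fun x => f₃ x.1 x.2))) h
    rw [← sum_card_fiber (labelled g), ← sum_card_fiber (labelled g₀), map_sum, map_sum] at h'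
    simp only [map_nsmul, termExponent, map_add, Finsupp.linearCombination_single, one_smul,
      Sum.elim_inl, Sum.elim_inr, nsmul_eq_mul] at h'
    simp only [sub_mul, Finset.sum_sub_distrib]
    rw [sub_eq_zero]
    exact h'.symm
  have hNN : ∀ t, N t = N' t := by
    by_contra! hne
    obtain ⟨t, ht, hmin⟩ := Finset.exists_min_image (Finset.univ.filter fun t => N t ≠ N' t)
      Prod.fst (hne.imp fun t ht => by simpa using ht)
    have hlow : ∀ u : σ × Fin p × Fin q, u.1 < t.1 → N u = N' u := by
      intro u hu
      by_contra hu'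
      exact absurd (hmin u (by simpa using hu')) (not_le.2 hu)
    have hcell : ∀ ab, N (t.1, ab) ≤ N' (t.1, ab) := fun ab =>
      filling_le_of_marginals_eq hlt ha hb N N' hN hm (t.1, ab) hlow
    -- Smaller cells take precedence in the lexicographic order, so a surplus in the first differing
    -- cell makes `μ` larger than `lam`.
    refine absurd hle (not_le.2 (Finsupp.Lex.lt_iff.2 ⟨t.1, fun x hx => ?_, ?_⟩))
    · change lam x = μ x
      rw [← sum_card_labelled g₀ x, ← sum_card_labelled g x]
      exact Finset.sum_congr rfl fun ab _ => hlow (x, ab) hx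
    · change lam t.1 < μ t.1
      rw [← sum_card_labelled g₀ t.1, ← sum_card_labelled g t.1]
      exact Finset.sum_lt_sum (fun ab _ => hcell ab) ⟨t.2, Finset.mem_univ _,
        lt_of_le_of_ne (hcell t.2) (Finset.mem_filter.1 ht).2⟩
  refine ⟨?_, fun e => ?_⟩
  · ext z
    rw [← sum_card_labelled g₀ z, ← sum_card_labelled g z]
    exact Finset.sum_congr rfl fun ab _ => (hNN (z, ab)).symm
  · refine (hN (labelled g e) ?_).2
    rw [hNN]
    exact Finset.card_ne_zero.2 ⟨e, by simp⟩

/-- The exponent of the level filling has coefficient `1` in the image of the leading monomial and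
`0` in the images of smaller ones, so in the image of `f` its coefficient is the leading coefficient
of `f`. -/
theorem parametrization_ne_zero [LinearOrder σ] {K : Type*} [Field K] {s r c : σ → ℕ}
    (hlt : ∀ x y : σ, x < y ↔ s x < s y ∨ s x = s y ∧ (r x < r y ∨ r x = r y ∧ c x < c y))
    {f : MvPolynomial σ K} (hf : f ≠ 0) {la lb : σ → ℕ}
    (ha : IsLevel (ChainLt s r c) ((MonomialOrder.lex (σ := σ)).degree f).support la)
    (hb : IsLevel (ChainLt s c r) ((MonomialOrder.lex (σ := σ)).degree f).support lb)
    (hap : ∀ z ∈ ((MonomialOrder.lex (σ := σ)).degree f).support, la z < p)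
    (hbq : ∀ z ∈ ((MonomialOrder.lex (σ := σ)).degree f).support, lb z < q) :
    parametrization K s r c p q f ≠ 0 := by
  set lam := (MonomialOrder.lex (σ := σ)).degree f with hlam
  have hmem : ∀ e : Σ z, Fin (lam z), e.1 ∈ lam.support := fun e =>
    Finsupp.mem_support_iff.2 (Nat.ne_of_gt (Fin.pos e.2))
  let g₀ : (Σ z, Fin (lam z)) → Fin p × Fin q := fun e =>
    (⟨la e.1, hap _ (hmem e)⟩, ⟨lb e.1, hbq _ (hmem e)⟩)
  have hcoeff : ∀ μ : σ →₀ ℕ, toLex μ ≤ toLex lam →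
      coeff (∑ e, termExponent s r c (labelled g₀ e))
        (parametrization K s r c p q (monomial μ 1)) = if μ = lam then 1 else 0 := by
    intro μ hμ
    rw [parametrization_monomial, coeff_sum]
    simp only [coeff_monomial]
    have key := fun g h => labelled_of_termExponent_eq (p := p) (q := q) hlt ha hb g₀
      (fun e => ⟨rfl, rfl⟩) (μ := μ) g hμ h
    split_ifs with h
    · subst h
      rw [Finset.sum_eq_single g₀]
      · simp
      · intro g _ hg
        refine if_neg fun h => hg (funext fun e => Prod.ext (Fin.ext ?_) (Fin.ext ?_))
        · exact ((key g h).2 e).1.symm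
        · exact ((key g h).2 e).2.symm
      · simp
    · exact Finset.sum_eq_zero fun g _ => if_neg fun h' => h (key g h').1
  intro h0
  have hsum : parametrization K s r c p q f =
      ∑ μ ∈ f.support, C (coeff μ f) * parametrization K s r c p q (monomial μ 1) := by
    conv_lhs => rw [f.as_sum, map_sum]
    refine Finset.sum_congr rfl fun μ _ => ?_
    rw [← mul_one (coeff μ f), ← C_mul_monomial, map_mul, mul_one]
    congr 1
    exact (parametrization K s r c p q).commutes _
  have hc := congrArg (coeff (∑ e, termExponent s r c (labelled g₀ e))) (hsum.symm.trans h0)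
  rw [coeff_sum, coeff_zero, Finset.sum_eq_single lam] at hc
  · rw [coeff_C_mul, hcoeff lam le_rfl, if_pos rfl, mul_one] at hc
    exact (MonomialOrder.lex (σ := σ)).coeff_degree_ne_zero_iff.2 hf hc
  · intro μ hμ hne
    rw [coeff_C_mul, hcoeff μ ((MonomialOrder.lex (σ := σ)).le_degree hμ), if_neg hne, mul_zero]
  · intro h
    exact absurd ((MonomialOrder.lex (σ := σ)).degree_mem_support hf) h

end Parametrization

/-! ### Generation and Gröbner bases from divisibility of leading monomials -/

section Groebner

variable {σ K : Type*} [Field K] (m : MonomialOrder σ)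

theorem span_eq_of_forall_exists_degree_le {J : Ideal (MvPolynomial σ K)}
    {G : Set (MvPolynomial σ K)} (hGJ : G ⊆ J)
    (h : ∀ f ∈ J, f ≠ 0 → ∃ g ∈ G, g ≠ 0 ∧ m.degree g ≤ m.degree f) : Ideal.span G = J := by
  refine le_antisymm (Ideal.span_le.2 hGJ) fun f hf => ?_
  induction hd : m.toSyn (m.degree f) using WellFoundedLT.induction generalizing f with
  | ind d ih =>
    subst hd
    by_cases hf0 : f = 0
    · exact hf0 ▸ zero_mem _
    obtain ⟨g, hg, hg0, hle⟩ := h f hf hf0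
    have hu : IsUnit (m.leadingCoeff g) := (m.leadingCoeff_ne_zero_iff.2 hg0).isUnit
    -- In degree `0` reduction cannot lower the degree, but then `g` is a nonzero constant and its
    -- span is everything.
    by_cases hdeg : m.degree f = 0
    · have hg1 : m.degree g = 0 := nonpos_iff_eq_zero.1 (hdeg ▸ hle)
      have hgC := m.eq_C_of_degree_eq_zero hg1
      have : IsUnit g := hgC ▸ hu.map C
      rw [Ideal.eq_top_of_isUnit_mem _ (Ideal.subset_span hg) this]
      trivial
    · have hr := ih _ (m.degree_reduce_lt hu hle hdeg) (m.reduce hu f)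
        (J.sub_mem hf (J.mul_mem_left _ (hGJ hg))) rfl
      have := (Ideal.span G).add_mem hr (Ideal.mul_mem_left _
        (monomial (m.degree f - m.degree g) (hu.unit⁻¹ * m.leadingCoeff f))
        (Ideal.subset_span hg))
      simpa [MonomialOrder.reduce] using this

theorem span_leadingTerm_eq_of_forall_exists_degree_le {J : Ideal (MvPolynomial σ K)}
    {G : Set (MvPolynomial σ K)} (hGJ : G ⊆ J)
    (h : ∀ f ∈ J, f ≠ 0 → ∃ g ∈ G, g ≠ 0 ∧ m.degree g ≤ m.degree f) :
    Ideal.span (m.leadingTerm '' (J : Set (MvPolynomial σ K))) =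
      Ideal.span (m.leadingTerm '' G) := by
  refine le_antisymm (Ideal.span_le.2 ?_) (Ideal.span_mono (Set.image_mono hGJ))
  rintro _ ⟨f, hf, rfl⟩
  by_cases hf0 : f = 0
  · rw [hf0, m.leadingTerm_zero]
    exact zero_mem _
  obtain ⟨g, hg, hg0, hle⟩ := h f hf hf0
  have hmul : m.leadingTerm f =
      monomial (m.degree f - m.degree g) (m.leadingCoeff f / m.leadingCoeff g) *
        m.leadingTerm g := by
    rw [MonomialOrder.leadingTerm, MonomialOrder.leadingTerm, monomial_mul,
      tsub_add_cancel_of_le hle, div_mul_cancel₀ _ (m.leadingCoeff_ne_zero_iff.2 hg0)]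
  rw [SetLike.mem_coe, hmul]
  exact Ideal.mul_mem_left _ _ (Ideal.subset_span ⟨g, hg, rfl⟩)

end Groebner

/-! ### Diagonal leading monomials of determinants -/

section Diagonal

variable {σ : Type*} [LinearOrder σ] {u : ℕ}

/-- At the first index `t` moved by `π`, the variable `w t t` is lost, while every variable used
from `t` on comes after it. -/
theorem toLex_sum_single_perm_lt (w : Fin u → Fin u → σ)
    (hw : ∀ t x y, t ≤ x → t ≤ y → (x, y) ≠ (t, t) → w t t < w x y) (π : Equiv.Perm (Fin u))
    (hπ : π ≠ 1) :
    toLex (∑ i, Finsupp.single (w (π i) i) 1) < toLex (∑ i, Finsupp.single (w i i) 1) := by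
  classical
  have hne : (Finset.univ.filter fun i => π i ≠ i).Nonempty := by
    by_contra h
    refine hπ (Equiv.ext fun i => ?_)
    rw [Finset.not_nonempty_iff_eq_empty, Finset.filter_eq_empty_iff] at h
    simpa using h (Finset.mem_univ i)
  obtain ⟨t, ht, hmin⟩ := Finset.exists_min_image _ id hne
  have ht' : π t ≠ t := (Finset.mem_filter.1 ht).2
  have hfix : ∀ i < t, π i = i := fun i hi => by
    by_contra h
    exact absurd (hmin i (by simpa using h)) (not_le.2 hi)
  have hge : ∀ i, t ≤ i → t ≤ π i := fun i hi => by
    by_contra! h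
    have := π.injective (hfix _ h)
    exact absurd (this ▸ h) (not_lt.2 hi)
  have hgt : ∀ i, t ≤ i → w t t < w (π i) i := fun i hi =>
    hw t (π i) i (hge i hi) hi fun h => by
      simp only [Prod.mk.injEq] at h
      exact ht' (h.2 ▸ h.1)
  rw [Finsupp.Lex.lt_iff]
  refine ⟨w t t, fun v hv => ?_, ?_⟩
  · simp only [ofLex_toLex, Finsupp.finsetSum_apply]
    refine Finset.sum_congr rfl fun i _ => ?_
    rcases lt_or_ge i t with hi | hi
    · rw [hfix i hi]
    · have h₂ : w t t ≤ w i i := by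
        rcases eq_or_lt_of_le hi with rfl | hi'
        · exact le_rfl
        · exact (hw t i i hi hi fun h => hi'.ne' (congrArg Prod.fst h)).le
      rw [Finsupp.single_eq_of_ne (hv.trans (hgt i hi)).ne,
        Finsupp.single_eq_of_ne (hv.trans_le h₂).ne]
  · simp only [ofLex_toLex, Finsupp.finsetSum_apply]
    refine Finset.sum_lt_sum (fun i _ => ?_) ⟨t, Finset.mem_univ _, ?_⟩
    · rcases lt_or_ge i t with hi | hi
      · rw [hfix i hi]
      · rw [Finsupp.single_eq_of_ne (hgt i hi).ne]
        exact Nat.zero_le _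
    · rw [Finsupp.single_eq_of_ne (hgt t le_rfl).ne, Finsupp.single_eq_same]
      exact Nat.one_pos

theorem degree_det_X [WellFoundedGT σ] (K : Type*) [Field K] (w : Fin u → Fin u → σ)
    (hw : ∀ t x y, t ≤ x → t ≤ y → (x, y) ≠ (t, t) → w t t < w x y) :
    (Matrix.of fun x y => (X (w x y) : MvPolynomial σ K)).det ≠ 0 ∧
      (MonomialOrder.lex (σ := σ)).degree (Matrix.of fun x y => (X (w x y) : MvPolynomial σ K)).det
        = ∑ i, Finsupp.single (w i i) 1 := by
  classical
  set d := (Matrix.of fun x y => (X (w x y) : MvPolynomial σ K)).det with hd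
  have hcoeff : ∀ μ, coeff μ d = ∑ π : Equiv.Perm (Fin u),
      if (∑ i, Finsupp.single (w (π i) i) 1) = μ then ((Equiv.Perm.sign π : ℤ) : K) else 0 := by
    intro μ
    rw [hd, Matrix.det_apply', coeff_sum]
    refine Finset.sum_congr rfl fun π _ => ?_
    simp only [Matrix.of_apply]
    have : (∏ i, X (w (π i) i) : MvPolynomial σ K) =
        monomial (∑ i, Finsupp.single (w (π i) i) 1) 1 := by
      rw [monomial_sum_one]
      rfl
    rw [this, ← map_intCast (C : K →+* MvPolynomial σ K), coeff_C_mul,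
      coeff_monomial, mul_ite, mul_one, mul_zero]
  have h1 : coeff (∑ i, Finsupp.single (w i i) 1) d = 1 := by
    rw [hcoeff, Finset.sum_eq_single 1]
    · simp
    · intro π _ hπ
      exact if_neg fun h => (toLex_sum_single_perm_lt w hw π hπ).ne (congrArg toLex h)
    · simp
  have hmem : (∑ i, Finsupp.single (w i i) 1) ∈ d.support := by
    rw [mem_support_iff, h1]
    exact one_ne_zero
  refine ⟨fun h => by simp [h] at hmem, ?_⟩
  apply (MonomialOrder.lex (σ := σ)).toSyn.injective
  refine le_antisymm ?_ ((MonomialOrder.lex (σ := σ)).le_degree hmem)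
  rw [MonomialOrder.degree_le_iff]
  intro μ hμ
  rw [mem_support_iff, hcoeff] at hμ
  obtain ⟨π, -, hπ⟩ := Finset.exists_ne_zero_of_sum_ne_zero hμ
  obtain rfl : _ = μ := by
    by_contra h
    exact hπ (if_neg h)
  by_cases hπ1 : π = 1
  · subst hπ1
    exact le_rfl
  · exact (toLex_sum_single_perm_lt w hw π hπ1).le

end Diagonal

/-! ### Minors and rank -/

section Minors

theorem exists_orderEmbedding_comp_perm {u v : ℕ} (γ : Fin u → Fin v)
    (hγ : Function.Injective γ) :
    ∃ (f : Fin u ↪o Fin v) (π : Equiv.Perm (Fin u)), γ = f ∘ π :=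
  ⟨OrderEmbedding.ofStrictMono (γ ∘ Tuple.sort γ)
    ((Tuple.monotone_sort γ).strictMono_of_injective (hγ.comp (Tuple.sort γ).injective)),
    (Tuple.sort γ)⁻¹, by ext; simp⟩

theorem finite_minors {R : Type*} [CommRing R] {p q : ℕ} (u : ℕ) (A : Matrix (Fin p) (Fin q) R) :
    (minors u A).Finite := by
  have h : ∀ v, Finite (Fin u ↪o Fin v) := fun v =>
    Finite.of_injective (fun f => (f : Fin u → Fin v)) DFunLike.coe_injective
  have := h p
  have := h q
  refine (Set.finite_range fun x : (Fin u ↪o Fin p) × (Fin u ↪o Fin q) =>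
    (A.submatrix x.1 x.2).det).subset ?_
  rintro _ ⟨r, c, rfl⟩
  exact ⟨(r, c), rfl⟩

theorem det_eq_zero_of_factorization {R : Type*} [CommRing R] [IsDomain R] {u p : ℕ} (hu : p < u)
    (A : Matrix (Fin u) (Fin u) R) (B : Matrix (Fin u) (Fin p) R) (C : Matrix (Fin p) (Fin u) R)
    (h : A = B * C) : A.det = 0 := by
  by_contra hA
  have h₁ := Matrix.rank_of_det_ne_zero hA
  have h₂ := (h ▸ Matrix.rank_mul_le_left B C).trans B.rank_le_width
  rw [Fintype.card_fin] at h₁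
  omega

variable {K : Type*} [Field K]

theorem exists_linearIndependent_rows {v u : ℕ} {ι : Type*} [Fintype ι]
    (A : Matrix (Fin v) ι K) (h : u ≤ A.rank) :
    ∃ f : Fin u ↪o Fin v, LinearIndependent K (A.submatrix f id).row := by
  obtain ⟨κ, g, hg, hspan, hli⟩ := exists_linearIndependent' K A.row
  have : Finite κ := Finite.of_injective g hg
  have := Fintype.ofFinite κ
  have hcard : Fintype.card κ = A.rank := by
    rw [Matrix.rank_eq_finrank_span_row, ← hspan, finrank_span_eq_card hli]
  obtain ⟨i⟩ : Nonempty (Fin u ↪ κ) := Function.Embedding.nonempty_of_card_le (by simp [hcard, h])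
  obtain ⟨f, π, hf⟩ := exists_orderEmbedding_comp_perm (g ∘ i) (hg.comp i.injective)
  refine ⟨f, ?_⟩
  have h₁ := (hli.comp i i.injective).comp π.symm π.symm.injective
  have h₂ : (A.row ∘ g) ∘ i = (A.submatrix f id).row ∘ π := by
    rw [Function.comp_assoc, hf]
    rfl
  rw [h₂] at h₁
  simpa [Function.comp_assoc] using h₁

theorem minors_eq_zero_iff_rank_le {v w : ℕ} (A : Matrix (Fin v) (Fin w) K) (u : ℕ) :
    (∀ d ∈ minors (u + 1) A, d = 0) ↔ A.rank ≤ u := by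
  constructor
  · intro h
    by_contra! hlt
    obtain ⟨f, hf⟩ := exists_linearIndependent_rows A hlt
    have h₁ := hf.rank_matrix
    rw [Fintype.card_fin, ← Matrix.rank_transpose] at h₁
    obtain ⟨g, hg⟩ := exists_linearIndependent_rows (A.submatrix f id).transpose h₁.ge
    have h₂ := (Matrix.isUnit_iff_isUnit_det _).1 (Matrix.linearIndependent_rows_iff_isUnit.1 hg)
    refine h₂.ne_zero ?_
    rw [← Matrix.det_transpose]
    exact h _ ⟨f, g, rfl⟩
  · rintro h _ ⟨f, g, rfl⟩
    by_contra hd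
    have h₁ := Matrix.rank_of_det_ne_zero hd
    have h₂ := A.rank_submatrix_le f g
    rw [Fintype.card_fin] at h₁
    omega

end Minors

/-! ### The kernel of the substitution -/

section Kernel

variable {σ K : Type*} [Field K] {s r c : σ → ℕ} {p q : ℕ}

theorem parametrization_X (z : σ) : parametrization K s r c p q (X z) =
    ∑ a, ∑ b, X (.inl (r z, a)) * X (.inr (.inl (s z, a, b))) * X (.inr (.inr (b, c z))) := by
  rw [parametrization, aeval_X, Fintype.sum_prod_type]
  refine Finset.sum_congr rfl fun a _ => Finset.sum_congr rfl fun b _ => ?_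
  simp only [termExponent, X, monomial_mul, one_mul]

/-- The row enters only through `P`, the slice and column only through `Y s * Q`, so the matrix
factors through dimension `p`. -/
theorem parametrization_det_row {u : ℕ} (hu : p < u) (w : Fin u → Fin u → σ)
    (hr : ∀ i l l', r (w i l) = r (w i l'))
    (hs : ∀ i i' l, s (w i l) = s (w i' l)) (hc : ∀ i i' l, c (w i l) = c (w i' l)) :
    parametrization K s r c p q (Matrix.of fun i l => X (w i l)).det = 0 := by
  rw [AlgHom.map_det]
  refine det_eq_zero_of_factorization hu _ (Matrix.of fun i a => X (.inl (r (w i i), a)))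
    (Matrix.of fun a l => ∑ b, X (.inr (.inl (s (w l l), a, b))) *
      X (.inr (.inr (b, c (w l l))))) ?_
  ext1 i l
  simp only [AlgHom.mapMatrix_apply, Matrix.map_apply, Matrix.of_apply, Matrix.mul_apply]
  rw [parametrization_X, hr i l i, hs i l l, hc i l l]
  simp only [Finset.mul_sum, mul_assoc]

theorem parametrization_det_col {u : ℕ} (hu : q < u) (w : Fin u → Fin u → σ)
    (hc : ∀ i l l', c (w i l) = c (w i l'))
    (hs : ∀ i i' l, s (w i l) = s (w i' l)) (hr : ∀ i i' l, r (w i l) = r (w i' l)) :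
    parametrization K s r c p q (Matrix.of fun i l => X (w i l)).det = 0 := by
  rw [AlgHom.map_det]
  refine det_eq_zero_of_factorization hu _
    (Matrix.of fun i b => X (.inr (.inr (b, c (w i i)))))
    (Matrix.of fun b l => ∑ a, X (.inl (r (w l l), a)) * X (.inr (.inl (s (w l l), a, b)))) ?_
  ext1 i l
  simp only [AlgHom.mapMatrix_apply, Matrix.map_apply, Matrix.of_apply, Matrix.mul_apply]
  rw [parametrization_X, hc i l i, hs i l l, hr i l l, Finset.sum_comm]
  simp only [Finset.mul_sum]
  exact Finset.sum_congr rfl fun b _ => Finset.sum_congr rfl fun a _ => mul_comm _ _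

theorem sum_single_le_of_injective {ι : Type*} [Fintype ι] {f : ι → σ}
    (hf : Function.Injective f) {lam : σ →₀ ℕ} (h : ∀ i, f i ∈ lam.support) :
    ∑ i, Finsupp.single (f i) 1 ≤ lam := by
  classical
  intro v
  rw [Finsupp.finsetSum_apply]
  by_cases hv : ∃ i, f i = v
  · obtain ⟨i, rfl⟩ := hv
    rw [Fintype.sum_eq_single i, Finsupp.single_eq_same]
    · exact Nat.one_le_iff_ne_zero.2 (Finsupp.mem_support_iff.1 (h i))
    · exact fun x hx => Finsupp.single_eq_of_ne fun h' => hx (hf h'.symm)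
  · push Not at hv
    rw [Finset.sum_eq_zero fun i _ => Finsupp.single_eq_of_ne (hv i).symm]
    exact Nat.zero_le _

variable [Fintype σ] [LinearOrder σ]

/-- If the products of the chains of length `p + 1` and `q + 1` are leading monomials of elements
of `G`, then every leading monomial of the kernel of the parametrization is divisible by a leading
monomial of an element of `G`. -/
theorem exists_degree_le_of_mem_ker
    (hlt : ∀ x y : σ, x < y ↔ s x < s y ∨ s x = s y ∧ (r x < r y ∨ r x = r y ∧ c x < c y))
    {G : Set (MvPolynomial σ K)}
    (hrow : ∀ f : Fin (p + 1) → σ, (∀ x y, x < y → ChainLt s r c (f x) (f y)) →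
      ∃ g ∈ G, g ≠ 0 ∧ (MonomialOrder.lex (σ := σ)).degree g = ∑ i, Finsupp.single (f i) 1)
    (hcol : ∀ f : Fin (q + 1) → σ, (∀ x y, x < y → ChainLt s c r (f x) (f y)) →
      ∃ g ∈ G, g ≠ 0 ∧ (MonomialOrder.lex (σ := σ)).degree g = ∑ i, Finsupp.single (f i) 1)
    (f : MvPolynomial σ K) (hf : f ∈ RingHom.ker (parametrization K s r c p q)) (hf0 : f ≠ 0) :
    ∃ g ∈ G, g ≠ 0 ∧
      (MonomialOrder.lex (σ := σ)).degree g ≤ (MonomialOrder.lex (σ := σ)).degree f := by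
  set lam := (MonomialOrder.lex (σ := σ)).degree f with hlam
  have hR : ∀ x y, ChainLt s r c x y → x < y := fun x y h => by
    rw [hlt]
    unfold ChainLt at h
    omega
  have hC : ∀ x y, ChainLt s c r x y → x < y := fun x y h => by
    rw [hlt]
    unfold ChainLt at h
    omega
  obtain ⟨la, ha⟩ := exists_isLevel (ChainLt s r c) hR lam.support
  obtain ⟨lb, hb⟩ := exists_isLevel (ChainLt s c r) hC lam.support
  by_cases hap : ∀ z ∈ lam.support, la z < p
  · by_cases hbq : ∀ z ∈ lam.support, lb z < q
    · exact absurd hf (parametrization_ne_zero hlt hf0 ha hb hap hbq)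
    · push Not at hbq
      obtain ⟨z, hz, hle⟩ := hbq
      obtain ⟨f, hfS, hfR⟩ := hb.exists_chain_of_le ChainLt.trans hz hle
      obtain ⟨g, hg, hg0, hdeg⟩ := hcol f hfR
      have hmono : StrictMono f := fun x y hxy => hC _ _ (hfR x y hxy)
      exact ⟨g, hg, hg0, hdeg ▸ sum_single_le_of_injective hmono.injective hfS⟩
  · push Not at hap
    obtain ⟨z, hz, hle⟩ := hap
    obtain ⟨f, hfS, hfR⟩ := ha.exists_chain_of_le ChainLt.trans hz hle
    obtain ⟨g, hg, hg0, hdeg⟩ := hrow f hfR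
    have hmono : StrictMono f := fun x y hxy => hR _ _ (hfR x y hxy)
    exact ⟨g, hg, hg0, hdeg ▸ sum_single_le_of_injective hmono.injective hfS⟩

end Kernel

/-! ### Flattenings, contractions and the zero set -/

section Flattening

variable {n : ℕ} {a : Fin n → ℕ}

@[simp]
theorem insertIndex_same (j : Fin n) (t : Fin (a j)) (x : MultiIndexAway a j) :
    insertIndex j t x j = t := by
  simp [insertIndex]

theorem insertIndex_of_ne (j : Fin n) (t : Fin (a j)) (x : MultiIndexAway a j) {i : Fin n}
    (hi : i ≠ j) : insertIndex j t x i = x ⟨i, hi⟩ := by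
  simp [insertIndex, hi]

/-- The multi-index with the `j`-th index removed. -/
def restrictAway (j : Fin n) (x : MultiIndex a) : MultiIndexAway a j := fun i => x i

theorem insertIndex_restrictAway (j : Fin n) (x : MultiIndex a) :
    insertIndex j (x j) (restrictAway j x) = x := by
  ext1 i
  by_cases hi : i = j
  · subst hi
    simp
  · rw [insertIndex_of_ne _ _ _ hi, restrictAway]

variable {K : Type*} [Field K]

/-- In dual coordinates the contraction is the transpose of the flattening, and reordering columns
preserves rank. -/
theorem finrank_range_contraction (T : Tensor K a) (j : Fin n)
    (e : Fin (flatteningWidth a j) ≃ MultiIndexAway a j) :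
    Module.finrank K (LinearMap.range (contraction T j)) =
      (Matrix.of fun t l => T (insertIndex j t (e l))).rank := by
  set A : Matrix (Fin (a j)) (MultiIndexAway a j) K :=
    Matrix.of fun t x => T (insertIndex j t x) with hA
  have h : (Matrix.of fun t l => T (insertIndex j t (e l))) =
      A.submatrix (Equiv.refl _) e := rfl
  rw [h, Matrix.rank_submatrix, ← Matrix.rank_transpose, Matrix.rank]
  have hcomp : contraction T j =
      A.transpose.mulVecLin ∘ₗ ((Pi.basisFun K (Fin (a j))).constr K).symm.toLinearMap := by
    refine LinearMap.ext fun f => funext fun x => ?_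
    change f (fun t => T (insertIndex j t x)) = _
    rw [← (Pi.basisFun K (Fin (a j))).sum_repr fun t => T (insertIndex j t x), map_sum]
    simp [Matrix.vecMul, dotProduct, hA, Module.Basis.constr, mul_comm]
  rw [hcomp, LinearMap.range_comp_of_range_eq_top _ (LinearEquiv.range _)]

theorem aeval_minors_eq_zero_iff {j : Fin n}
    {M : Matrix (Fin (a j)) (Fin (flatteningWidth a j)) (MvPolynomial (MultiIndex a) K)}
    (hM : M ∈ flatteningClass K a j) (u : ℕ) (T : Tensor K a) :
    (∀ d ∈ minors (u + 1) M, aeval T d = 0) ↔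
      Module.finrank K (LinearMap.range (contraction T j)) ≤ u := by
  obtain ⟨e, rfl⟩ := hM
  rw [finrank_range_contraction T j e, ← minors_eq_zero_iff_rank_le]
  have hdet : ∀ (f : Fin (u + 1) ↪o Fin (a j)) (g : Fin (u + 1) ↪o Fin (flatteningWidth a j)),
      aeval T (((Matrix.of fun t l => (X (insertIndex j t (e l)) : MvPolynomial (MultiIndex a) K)
        ).submatrix f g).det) =
      ((Matrix.of fun t l => T (insertIndex j t (e l))).submatrix f g).det := by
    intro f g
    rw [AlgHom.map_det]
    congr 1
    ext1 x y
    simp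
  constructor
  · rintro h _ ⟨f, g, rfl⟩
    rw [← hdet]
    exact h _ ⟨f, g, rfl⟩
  · rintro h _ ⟨f, g, rfl⟩
    rw [hdet]
    exact h _ ⟨f, g, rfl⟩

theorem zeroLocus_minors_eq_subspaceVariety {b : Fin n → ℕ} {j k : Fin n}
    (hb : ∀ i, i ≠ j → i ≠ k → a i ≤ b i)
    {Xj : Matrix (Fin (a j)) (Fin (flatteningWidth a j)) (MvPolynomial (MultiIndex a) K)}
    (hj : Xj ∈ flatteningClass K a j)
    {Xk : Matrix (Fin (a k)) (Fin (flatteningWidth a k)) (MvPolynomial (MultiIndex a) K)}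
    (hk : Xk ∈ flatteningClass K a k) :
    zeroLocus K (Ideal.span (minors (b j + 1) Xj ∪ minors (b k + 1) Xk)) =
      subspaceVariety K a b := by
  ext T
  rw [zeroLocus_span, Set.mem_ofPred_eq]
  simp only [Set.mem_union, or_imp, forall_and]
  rw [aeval_minors_eq_zero_iff hj, aeval_minors_eq_zero_iff hk]
  refine ⟨fun h i => ?_, fun h => ⟨h j, h k⟩⟩
  by_cases hij : i = j
  · exact hij ▸ h.1
  by_cases hik : i = k
  · exact hik ▸ h.2
  · refine ((contraction T i).finrank_range_le.trans ?_).trans (hb i hij hik)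
    rw [Subspace.dual_finrank_eq, Module.finrank_fin_fun]

/-- A minor of a flattening whose rows and columns are picked by a sequence of cells is, up to
sign, the determinant of the corresponding variables. -/
theorem exists_mem_minors_of_chain {j : Fin n}
    {M : Matrix (Fin (a j)) (Fin (flatteningWidth a j)) (MvPolynomial (MultiIndex a) K)}
    (hM : M ∈ flatteningClass K a j) {u : ℕ} (f : Fin u → MultiIndex a)
    (hrow : StrictMono fun x => f x j)
    (hcol : Function.Injective fun x => restrictAway j (f x)) :
    ∃ d ∈ minors u M,
      d = (Matrix.of fun x y => X (insertIndex j (f x j) (restrictAway j (f y)))).det ∨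
      d = -(Matrix.of fun x y => X (insertIndex j (f x j) (restrictAway j (f y)))).det := by
  obtain ⟨e, rfl⟩ := hM
  obtain ⟨g, π, hg⟩ := exists_orderEmbedding_comp_perm
    (fun x => e.symm (restrictAway j (f x))) (e.symm.injective.comp hcol)
  refine ⟨_, ⟨OrderEmbedding.ofStrictMono _ hrow, g, rfl⟩, ?_⟩
  set A := (Matrix.of fun t l => (X (insertIndex j t (e l)) : MvPolynomial (MultiIndex a) K)
    ).submatrix (OrderEmbedding.ofStrictMono _ hrow) g with hA
  have h : (Matrix.of fun x y => (X (insertIndex j (f x j) (restrictAway j (f y))) :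
      MvPolynomial (MultiIndex a) K)) = A.submatrix id π := by
    ext1 x y
    have hy : e (g (π y)) = restrictAway j (f y) :=
      (e.symm_apply_eq.1 (congrFun hg y)).symm
    simp [hA, hy]
  rw [h, Matrix.det_permute']
  rcases Int.units_eq_one_or (Equiv.Perm.sign π) with h' | h' <;> simp [h']

end Flattening

/-! ### Slice, row and column coordinates -/

section Coordinates

variable {n : ℕ} {a : Fin n → ℕ}

/-- A numbering of the slices of a tensor in directions `j` and `k`. -/
noncomputable def sliceCoord (a : Fin n → ℕ) (j k : Fin n) (x : MultiIndex a) : ℕ :=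
  Fintype.equivFin ((i : {i : Fin n // i ≠ j ∧ i ≠ k}) → Fin (a i)) fun i => x i

/-- The row of an entry of a tensor in its slice in directions `j` and `k`. -/
def rowCoord (a : Fin n → ℕ) (j : Fin n) (x : MultiIndex a) : ℕ := x j

/-- The column of an entry of a tensor in its slice in directions `j` and `k`; there is only one
column if `j = k`. -/
def colCoord (a : Fin n → ℕ) (j k : Fin n) (x : MultiIndex a) : ℕ := if j = k then 0 else x k

theorem sliceCoord_congr {j k : Fin n} {x y : MultiIndex a}
    (h : ∀ i, i ≠ j → i ≠ k → x i = y i) : sliceCoord a j k x = sliceCoord a j k y := by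
  unfold sliceCoord
  congr 2
  exact funext fun i => h i i.2.1 i.2.2

theorem eq_of_coord_eq {j k : Fin n} {x y : MultiIndex a}
    (hs : sliceCoord a j k x = sliceCoord a j k y) (hr : rowCoord a j x = rowCoord a j y)
    (hc : colCoord a j k x = colCoord a j k y) : x = y := by
  have hs' := (Fintype.equivFin _).injective (Fin.ext hs)
  ext1 i
  by_cases hij : i = j
  · exact hij ▸ Fin.ext hr
  by_cases hik : i = k
  · subst hik
    rw [colCoord, colCoord, if_neg (Ne.symm hij), if_neg (Ne.symm hij)] at hc
    exact Fin.ext hc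
  · exact congrFun hs' ⟨i, hij, hik⟩

/-- Both chain relations refine to this one order, which depends only on `a`, `j`, `k` and not on
the flattening matrices. -/
theorem exists_linearOrder (a : Fin n → ℕ) (j k : Fin n) :
    ∃ L : LinearOrder (MultiIndex a), ∀ x y, L.lt x y ↔
      sliceCoord a j k x < sliceCoord a j k y ∨ sliceCoord a j k x = sliceCoord a j k y ∧
        (rowCoord a j x < rowCoord a j y ∨ rowCoord a j x = rowCoord a j y ∧
          colCoord a j k x < colCoord a j k y) := by
  refine ⟨LinearOrder.lift' (fun x : MultiIndex a =>
    toLex (sliceCoord a j k x, toLex (rowCoord a j x, colCoord a j k x))) ?_, fun x y => ?_⟩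
  · intro x y h
    simp only [EmbeddingLike.apply_eq_iff_eq, Prod.mk.injEq] at h
    exact eq_of_coord_eq h.1 h.2.1 h.2.2
  · change toLex (sliceCoord a j k x, toLex (rowCoord a j x, colCoord a j k x)) <
      toLex (sliceCoord a j k y, toLex (rowCoord a j y, colCoord a j k y)) ↔ _
    simp only [Prod.Lex.toLex_lt_toLex]

variable {K : Type*} [Field K] {j k : Fin n} (x : MultiIndex a)

theorem rowCoord_insertIndex_row (t : Fin (a j)) (y : MultiIndexAway a j) :
    rowCoord a j (insertIndex j t y) = t := by
  rw [rowCoord, insertIndex_same]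

theorem sliceCoord_insertIndex_row (t : Fin (a j)) :
    sliceCoord a j k (insertIndex j t (restrictAway j x)) = sliceCoord a j k x :=
  sliceCoord_congr fun _ hi _ => insertIndex_of_ne _ _ _ hi

theorem colCoord_insertIndex_row (t : Fin (a j)) :
    colCoord a j k (insertIndex j t (restrictAway j x)) = colCoord a j k x := by
  unfold colCoord
  split_ifs with h
  · rfl
  · rw [insertIndex_of_ne _ _ _ (Ne.symm h)]
    rfl

theorem colCoord_insertIndex_col (h : j ≠ k) (t : Fin (a k)) (y : MultiIndexAway a k) :
    colCoord a j k (insertIndex k t y) = t := by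
  rw [colCoord, if_neg h, insertIndex_same]

theorem sliceCoord_insertIndex_col (t : Fin (a k)) :
    sliceCoord a j k (insertIndex k t (restrictAway k x)) = sliceCoord a j k x :=
  sliceCoord_congr fun _ _ hi => insertIndex_of_ne _ _ _ hi

theorem rowCoord_insertIndex_col (h : j ≠ k) (t : Fin (a k)) :
    rowCoord a j (insertIndex k t (restrictAway k x)) = rowCoord a j x := by
  rw [rowCoord, insertIndex_of_ne _ _ _ h]
  rfl

theorem parametrization_minor_row
    {M : Matrix (Fin (a j)) (Fin (flatteningWidth a j)) (MvPolynomial (MultiIndex a) K)}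
    (hM : M ∈ flatteningClass K a j) {p q : ℕ} {d : MvPolynomial (MultiIndex a) K}
    (hd : d ∈ minors (p + 1) M) :
    parametrization K (sliceCoord a j k) (rowCoord a j) (colCoord a j k) p q d = 0 := by
  obtain ⟨e, rfl⟩ := hM
  obtain ⟨f, g, rfl⟩ := hd
  -- Each column index is completed to a full cell using row `f 0`, so that the coordinate lemmas
  -- for `restrictAway` apply.
  have h : ∀ l, ∃ x, e (g l) = restrictAway j (insertIndex j (f 0) x) := fun l =>
    ⟨e (g l), funext fun i => (insertIndex_of_ne _ _ _ i.2).symm⟩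
  choose x hx using h
  refine parametrization_det_row (Nat.lt_succ_self p)
    (fun i l => insertIndex j (f i) (e (g l))) ?_ ?_ ?_
  · intro i l l'
    simp only [rowCoord_insertIndex_row]
  · intro i i' l
    simp only [hx, sliceCoord_insertIndex_row]
  · intro i i' l
    simp only [hx, colCoord_insertIndex_row]

theorem parametrization_minor_col (hjk : j ≠ k)
    {M : Matrix (Fin (a k)) (Fin (flatteningWidth a k)) (MvPolynomial (MultiIndex a) K)}
    (hM : M ∈ flatteningClass K a k) {p q : ℕ} {d : MvPolynomial (MultiIndex a) K}
    (hd : d ∈ minors (q + 1) M) :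
    parametrization K (sliceCoord a j k) (rowCoord a j) (colCoord a j k) p q d = 0 := by
  obtain ⟨e, rfl⟩ := hM
  obtain ⟨f, g, rfl⟩ := hd
  have h : ∀ l, ∃ x, e (g l) = restrictAway k (insertIndex k (f 0) x) := fun l =>
    ⟨e (g l), funext fun i => (insertIndex_of_ne _ _ _ i.2).symm⟩
  choose x hx using h
  refine parametrization_det_col (Nat.lt_succ_self q)
    (fun i l => insertIndex k (f i) (e (g l))) ?_ ?_ ?_
  · intro i l l'
    simp only [colCoord_insertIndex_col hjk]
  · intro i i' l
    simp only [hx, sliceCoord_insertIndex_col]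
  · intro i i' l
    simp only [hx, rowCoord_insertIndex_col _ hjk]

end Coordinates

/-! ### Chains as leading monomials of minors -/

section LeadingMonomials

variable {n : ℕ} {a : Fin n → ℕ} {K : Type*} [Field K] {j k : Fin n}

instance wellFoundedGT_of_finite_linearOrder {σ : Type*} [Finite σ] [LinearOrder σ] :
    WellFoundedGT σ := inferInstance

theorem exists_mem_minors_degree [L : LinearOrder (MultiIndex a)]
    {M : Matrix (Fin (a j)) (Fin (flatteningWidth a j)) (MvPolynomial (MultiIndex a) K)}
    (hM : M ∈ flatteningClass K a j) {u : ℕ} (f : Fin u → MultiIndex a)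
    (hrow : StrictMono fun x => f x j)
    (hcol : Function.Injective fun x => restrictAway j (f x))
    (hw : ∀ t x y, t ≤ x → t ≤ y → (x, y) ≠ (t, t) →
      L.lt (f t) (insertIndex j (f x j) (restrictAway j (f y)))) :
    ∃ d ∈ minors u M, d ≠ 0 ∧
      (MonomialOrder.lex (σ := MultiIndex a)).degree d = ∑ i, Finsupp.single (f i) 1 := by
  obtain ⟨d, hd, hd'⟩ := exists_mem_minors_of_chain hM f hrow hcol
  obtain ⟨h₁, h₂⟩ := degree_det_X K
    (fun x y => insertIndex j (f x j) (restrictAway j (f y))) (by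
      intro t x y htx hty hne
      rw [insertIndex_restrictAway]
      exact hw t x y htx hty hne)
  simp only [insertIndex_restrictAway] at h₂
  refine ⟨d, hd, ?_⟩
  rcases hd' with rfl | rfl
  · exact ⟨h₁, h₂⟩
  · exact ⟨neg_ne_zero.2 h₁, by rw [MonomialOrder.degree_neg, h₂]⟩

/-- Entry `(x, y)` of the submatrix has the row of `f x` and the slice and column of `f y`; for `x,
y ≥ t` the chain condition puts `f t` before every other such entry. -/
theorem exists_mem_minors_degree_row [L : LinearOrder (MultiIndex a)]
    (hlt : ∀ x y, L.lt x y ↔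
      sliceCoord a j k x < sliceCoord a j k y ∨ sliceCoord a j k x = sliceCoord a j k y ∧
        (rowCoord a j x < rowCoord a j y ∨ rowCoord a j x = rowCoord a j y ∧
          colCoord a j k x < colCoord a j k y))
    {M : Matrix (Fin (a j)) (Fin (flatteningWidth a j)) (MvPolynomial (MultiIndex a) K)}
    (hM : M ∈ flatteningClass K a j) {u : ℕ} (f : Fin u → MultiIndex a)
    (hf : ∀ x y, x < y →
      ChainLt (sliceCoord a j k) (rowCoord a j) (colCoord a j k) (f x) (f y)) :
    ∃ d ∈ minors u M, d ≠ 0 ∧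
      (MonomialOrder.lex (σ := MultiIndex a)).degree d = ∑ i, Finsupp.single (f i) 1 := by
  unfold ChainLt at hf
  refine exists_mem_minors_degree hM f (fun x y hxy => (hf x y hxy).1) ?_ ?_
  · intro x y (hxy : restrictAway j (f x) = restrictAway j (f y))
    have hs := sliceCoord_insertIndex_row (k := k) (f x) (f x j)
    have hc := colCoord_insertIndex_row (k := k) (f x) (f x j)
    rw [hxy, sliceCoord_insertIndex_row] at hs
    rw [hxy, colCoord_insertIndex_row] at hc
    rcases lt_trichotomy x y with h | h | h
    · have := hf x y h
      omega
    · exact h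
    · have := hf y x h
      omega
  · intro t x y htx hty hne
    rw [hlt, sliceCoord_insertIndex_row, rowCoord_insertIndex_row, colCoord_insertIndex_row]
    change _ ∨ _ ∧ (_ < rowCoord a j (f x) ∨ _ = rowCoord a j (f x) ∧ _)
    rcases eq_or_lt_of_le htx with rfl | hx
    · rcases eq_or_lt_of_le hty with rfl | hy
      · exact absurd rfl hne
      · have := hf t y hy
        omega
    · have := hf t x hx
      rcases eq_or_lt_of_le hty with rfl | hy
      · omega
      · have := hf t y hy
        omega

theorem exists_mem_minors_degree_col [L : LinearOrder (MultiIndex a)] (hjk : j ≠ k)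
    (hlt : ∀ x y, L.lt x y ↔
      sliceCoord a j k x < sliceCoord a j k y ∨ sliceCoord a j k x = sliceCoord a j k y ∧
        (rowCoord a j x < rowCoord a j y ∨ rowCoord a j x = rowCoord a j y ∧
          colCoord a j k x < colCoord a j k y))
    {M : Matrix (Fin (a k)) (Fin (flatteningWidth a k)) (MvPolynomial (MultiIndex a) K)}
    (hM : M ∈ flatteningClass K a k) {u : ℕ} (f : Fin u → MultiIndex a)
    (hf : ∀ x y, x < y →
      ChainLt (sliceCoord a j k) (colCoord a j k) (rowCoord a j) (f x) (f y)) :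
    ∃ d ∈ minors u M, d ≠ 0 ∧
      (MonomialOrder.lex (σ := MultiIndex a)).degree d = ∑ i, Finsupp.single (f i) 1 := by
  have hcol : ∀ x : MultiIndex a, colCoord a j k x = x k := fun x => if_neg hjk
  unfold ChainLt at hf
  refine exists_mem_minors_degree hM f (fun x y hxy => ?_) ?_ ?_
  · have := (hf x y hxy).1
    rwa [hcol, hcol] at this
  · intro x y (hxy : restrictAway k (f x) = restrictAway k (f y))
    have hs := sliceCoord_insertIndex_col (j := j) (f x) (f x k)
    have hr := rowCoord_insertIndex_col (f x) hjk (f x k)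
    rw [hxy, sliceCoord_insertIndex_col] at hs
    rw [hxy, rowCoord_insertIndex_col _ hjk] at hr
    rcases lt_trichotomy x y with h | h | h
    · have := hf x y h
      omega
    · exact h
    · have := hf y x h
      omega
  · intro t x y htx hty hne
    rw [hlt, sliceCoord_insertIndex_col, rowCoord_insertIndex_col _ hjk,
      colCoord_insertIndex_col hjk, ← hcol]
    rcases eq_or_lt_of_le htx with rfl | hx
    · rcases eq_or_lt_of_le hty with rfl | hy
      · exact absurd rfl hne
      · have := hf t y hy
        omega
    · have := hf t x hx
      rcases eq_or_lt_of_le hty with rfl | hy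
      · omega
      · have := hf t y hy
        omega

/-- The minors generate the kernel of a parametrization, and their leading monomials generate the
leading monomials of this kernel. -/
theorem minors_generate_kernel (K : Type*) [Field K] (a b : Fin n → ℕ) (j k : Fin n) :
    ∃ (m : MonomialOrder.{0, 0} (MultiIndex a)) (J : Ideal (MvPolynomial (MultiIndex a) K)),
      J.IsPrime ∧ ∀ Xj ∈ flatteningClass K a j, ∀ Xk ∈ flatteningClass K a k,
        minors (b j + 1) Xj ∪ minors (b k + 1) Xk ⊆ J ∧
        ∀ f ∈ J, f ≠ 0 → ∃ g ∈ minors (b j + 1) Xj ∪ minors (b k + 1) Xk,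
          g ≠ 0 ∧ m.degree g ≤ m.degree f := by
  obtain ⟨L, hlt⟩ := exists_linearOrder a j k
  -- For `j = k` all cells have column `0`, so no column chain has two elements and `q = 1` imposes
  -- no further condition.
  refine ⟨MonomialOrder.lex, RingHom.ker (parametrization K (sliceCoord a j k) (rowCoord a j)
    (colCoord a j k) (b j) (if j = k then 1 else b k)), RingHom.ker_isPrime _,
    fun Xj hj Xk hk => ⟨Set.union_subset ?_ ?_, exists_degree_le_of_mem_ker hlt ?_ ?_⟩⟩
  · exact fun d hd => parametrization_minor_row hj hd
  · intro d hd
    by_cases h : j = k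
    · subst h
      exact parametrization_minor_row hk hd
    · rw [if_neg h]
      exact parametrization_minor_col h hk hd
  · intro f hf
    obtain ⟨g, hg, h⟩ := exists_mem_minors_degree_row hlt hj f hf
    exact ⟨g, Or.inl hg, h⟩
  · by_cases h : j = k
    · rw [if_pos h]
      intro f hf
      have := (hf 0 1 Fin.zero_lt_one).1
      simp [colCoord, h] at this
    · rw [if_neg h]
      intro f hf
      obtain ⟨g, hg, h⟩ := exists_mem_minors_degree_col h hlt hk f hf
      exact ⟨g, Or.inr hg, h⟩

end LeadingMonomials

end TensorFlattening

open TensorFlattening in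
theorem corollary3 {K : Type*} [Field K] {n : ℕ} (a b : Fin n → ℕ) (j k : Fin n)
    (hb : ∀ i, i ≠ j → i ≠ k → a i ≤ b i) :
    (∀ Xj ∈ flatteningClass K a j, ∀ Xk ∈ flatteningClass K a k,
      (Ideal.span (minors (b j + 1) Xj ∪ minors (b k + 1) Xk)).IsPrime ∧
      MvPolynomial.zeroLocus K (Ideal.span (minors (b j + 1) Xj ∪ minors (b k + 1) Xk)) =
        subspaceVariety K a b) ∧
    ∃ m : MonomialOrder.{0, 0} (MultiIndex a),
      ∀ Xj ∈ flatteningClass K a j, ∀ Xk ∈ flatteningClass K a k,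
        IsGroebnerBasis m (minors (b j + 1) Xj ∪ minors (b k + 1) Xk) := by
  obtain ⟨m, J, hJ, h⟩ := minors_generate_kernel K a b j k
  refine ⟨fun Xj hj Xk hk => ⟨?_, zeroLocus_minors_eq_subspaceVariety hb hj hk⟩,
    m, fun Xj hj Xk hk => ⟨(finite_minors _ _).union (finite_minors _ _), ?_⟩⟩
  · obtain ⟨h₁, h₂⟩ := h Xj hj Xk hk
    rwa [span_eq_of_forall_exists_degree_le m h₁ h₂]
  · obtain ⟨h₁, h₂⟩ := h Xj hj Xk hk
    rw [span_eq_of_forall_exists_degree_le m h₁ h₂]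
    exact span_leadingTerm_eq_of_forall_exists_degree_le m h₁ h₂
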